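/- Let $P$ be a poset, regarded as a category with a unique morphism $p\to q$ whenever $p\le q$. Let $X$ be the set of filters on $P$ (nonempty, downward directed, upward closed subsets), ordered by inclusion and equipped with the Scott topology. Identify each Grothendieck topology $J$ on $P$ with the subtopos $\mathrm{Sh}(P,J)$ of $\mathrm{PSh}(P)$. Write $\mathbf{p}=|P|$, $\mathbf{x}=|X|$, and let $\mathbf{gt}$ be the cardinality of the set of all Grothendieck topologies $J$ on $P$. Let $\mathbf{cl}$, $\mathbf{coh}$, $\mathbf{ep}$ be the cardinalities of the sets of those $J$ for which the subtopos $\mathrm{Sh}(P,J)$ is, respectively, closed; coherent; a topos with enough points. Here a subtopos is closed if, for some subterminal object $U$ of $\mathrm{PSh}(P)$, it consists of the presheaves $F$ for which the projection $F\times U\to U$ is an isomorphism. An object $E$ of a topos is compact if every epimorphic family with codomain $E$ contains a finite epimorphic subfamily. It is coherent if it is compact and, for all morphisms $E'\to E\leftarrow E''$ with $E',E''$ compact, the pullback $E'\times_E E''$ is compact. A topos is coherent if it contains a full subcategory of compact generators that is closed under finite limits. The subtopos $\mathrm{Sh}(P,J)$ is coherent if it is a coherent topos and sheafification $\mathrm{PSh}(P)\to\mathrm{Sh}(P,J)$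 preserves coherent objects. Suppose that $X$ is an infinite spectral space (sober, compact, and its compact open subsets are closed under binary intersections and form a basis). Then in the table $$\begin{array}{cccc} & & & 2^{(2^{\mathbf p})}\\ & & \mathbf{gt} & 2^{\mathbf{cl}}\\ & 2^{\mathbf p} & \mathbf{ep} & 2^{\mathbf x}\\ \mathbf{x} & \mathbf{cl} & \mathbf{coh} & 2^{\mathbf p} \end{array}$$ each cardinality is less than or equal to the cardinality directly to the right of it and to the cardinality directly above it, whenever there is one. That is: $$\mathbf{x}\le\mathbf{cl}\le\mathbf{coh}\le 2^{\mathbf p},\qquad 2^{\mathbf p}\le\mathbf{ep}\le 2^{\mathbf x},\qquad \mathbf{gt}\le 2^{\mathbf{cl}},$$ $$\mathbf{cl}\le 2^{\mathbf p},\qquad \mathbf{coh}\le\mathbf{ep}\le\mathbf{gt},\qquad 2^{\mathbf p}\le 2^{\mathbf x}\le 2^{\mathbf{cl}}\le 2^{(2^{\mathbf p})}.$$ -/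

import Mathlib

open CategoryTheory Limits Opposite Order

universe u v w

namespace PosetSites

/-! ### The dcpo of filters -/

/-- The set of filters on `P`, ordered by inclusion, with the Scott topology. -/
instance filterTopology (P : Type u) [PartialOrder P] : TopologicalSpace (PFilter P) :=
  Topology.scott (PFilter P) Set.univ

instance filterTopology_isScott (P : Type u) [PartialOrder P] :
    Topology.IsScott (PFilter P) Set.univ := ⟨rfl⟩

/-! ### Compact objects, coherent objects, coherent toposes -/

section Coherent

variable {C : Type w} [Category.{v} C]

/-- The family of morphisms `f i : A i ⟶ E` is (jointly) epimorphic. -/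
def IsEpimorphicFamily {ι : Type v} {A : ι → C} {E : C} (f : ∀ i, A i ⟶ E) : Prop :=
  ∀ ⦃Z : C⦄ (g h : E ⟶ Z), (∀ i, f i ≫ g = f i ≫ h) → g = h

/-- `E` is compact: every epimorphic family with codomain `E` contains a finite epimorphic
subfamily. -/
def IsCompactObj (E : C) : Prop :=
  ∀ ⦃ι : Type v⦄ (A : ι → C) (f : ∀ i, A i ⟶ E), IsEpimorphicFamily f →
    ∃ s : Finset ι, IsEpimorphicFamily (fun i : s => f i.1)

/-- `E` is coherent: it is compact, and any diagram `E' ⟶ E ⟵ E''` with `E'` and `E''` compact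
has a compact pullback. -/
def IsCoherentObj (E : C) : Prop :=
  IsCompactObj E ∧
    ∀ ⦃E' E'' Q : C⦄ (f : E' ⟶ E) (g : E'' ⟶ E) (fst : Q ⟶ E') (snd : Q ⟶ E''),
      IsCompactObj E' → IsCompactObj E'' → IsPullback fst snd f g → IsCompactObj Q

variable (C) in
/-- The topos `C` is coherent: it contains a full subcategory of compact generators that is closed
under finite limits. -/
def IsCoherentTopos : Prop :=
  ∃ K : ObjectProperty C,
    (∀ E : C, K E → IsCompactObj E) ∧ K.IsSeparating ∧
      ∀ (D : Type) [SmallCategory D] [FinCategory D], K.IsClosedUnderLimitsOfShape D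

end Coherent

/-! ### Subtoposes of presheaves on a poset

The subtopos of `Pᵒᵖ ⥤ Type u` given by a Grothendieck topology `J` on `P` is `Sheaf J (Type u)`;
its inclusion has sheafification as inverse image functor. -/

section Subtoposes

variable {P : Type u} [PartialOrder P]

/-- The subtopos of sheaves for `J` is closed: for some subterminal presheaf `U`, it consists of
the presheaves `F` such that the projection `F × U ⟶ U` is an isomorphism (so it is the closed
complement of the open subtopos given by `U`). -/
def IsClosedSubtopos (J : GrothendieckTopology P) : Prop :=
  ∃ U : Pᵒᵖ ⥤ Type u, IsSubterminal U ∧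
    ∀ F : Pᵒᵖ ⥤ Type u, Presheaf.IsSheaf J F ↔ IsIso (prod.snd : F ⨯ U ⟶ U)

/-- The subtopos of sheaves for `J` is coherent: it is a coherent topos, and the inverse image
functor of the inclusion preserves coherent objects. -/
def IsCoherentSubtopos (J : GrothendieckTopology P) : Prop :=
  IsCoherentTopos (Sheaf J (Type u)) ∧
    ∀ F : Pᵒᵖ ⥤ Type u, IsCoherentObj F → IsCoherentObj ((presheafToSheaf J (Type u)).obj F)

variable (P)

/-- The number of closed subtoposes. -/
def cl : Cardinal.{u} := Cardinal.mk {J : GrothendieckTopology P // IsClosedSubtopos J}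

/-- The number of coherent subtoposes. -/
def coh : Cardinal.{u} := Cardinal.mk {J : GrothendieckTopology P // IsCoherentSubtopos J}

/-- The number of subtoposes with enough points. -/
def ep : Cardinal.{u} :=
  Cardinal.mk {J : GrothendieckTopology P // GrothendieckTopology.HasEnoughPoints.{u} J}

/-- The number of Grothendieck topologies. -/
def gt : Cardinal.{u} := Cardinal.mk (GrothendieckTopology P)

/-- The number of elements of `P`. -/
def p : Cardinal.{u} := Cardinal.mk P

/-- The number of filters on `P`. -/
def x : Cardinal.{u} := Cardinal.mk (PFilter P)

end Subtoposes

end PosetSites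

/-!
Since `P` has at most one morphism between two elements, a topology on `P` amounts to a relation
between lower sets `D` and elements `p`, saying that `D` covers `p`.

The closed subtopos complementary to a lower set `Aᶜ` consists of the presheaves on the upper set
`A`, with restriction to `A` as sheafification. When the space of filters is spectral, the sets `P`
and `Iic p ∩ Iic q` are finitely generated lower sets, because they index compact unions of basic
open sets. It follows that the presheaf topos on `A` is coherent. The restriction to `A` preserves
coherent presheaves because it has a fully faithful left adjoint and preserves compact presheaves.
Hence closed subtoposes are coherent.

Representable presheaves are coherent, so in a coherent subtopos their sheafifications
are compact. Then every cover contains a finite one. Such a topology is determined by the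
pairs `(T, p)` in which the lower closure of the finite set `T` covers `p`, and it has enough points
by a theorem of Deligne.

A point of the site `(P, J)` is a filter that meets every lower set covering one of its elements, so
a topology with enough points is determined by the set of its points. Every subset `A` of `P`
provides a topology with enough points, whose sheaves are the presheaves on `A`, and `A` can be
recovered from it.
-/

namespace PosetSites

/-! ### Grothendieck topologies on a poset -/

section Topologies

variable {P : Type u} [PartialOrder P]

/-- The sieve on `p` cut out by a lower set. Since there is at most one morphism between two
elements of `P`, sieves on `p` are handled through lower sets of `P`. -/
def sieveOf (D : LowerSet P) (p : P) : Sieve p where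
  arrows q _ := q ∈ D
  downward_closed hf g := D.lower (leOfHom g) hf

/-- The lower set of the domains of the morphisms in a sieve. -/
def sieveDomain {p : P} (S : Sieve p) : LowerSet P where
  carrier := {q | ∃ f : q ⟶ p, S f}
  lower' := by
    rintro q r hrq ⟨f, hf⟩
    exact ⟨homOfLE hrq ≫ f, S.downward_closed hf _⟩

lemma sieveOf_sieveDomain {p : P} (S : Sieve p) : sieveOf (sieveDomain S) p = S := by
  ext q f
  refine ⟨fun ⟨g, hg⟩ ↦ ?_, fun hf ↦ ⟨f, hf⟩⟩
  rwa [Subsingleton.elim f g]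

/-- The lower set `D` covers `p` if the sieve it cuts out on `p` is covering. -/
def Covers (J : GrothendieckTopology P) (D : LowerSet P) (p : P) : Prop :=
  sieveOf D p ∈ J p

variable {J K : GrothendieckTopology P} {D E : LowerSet P} {p q : P}

lemma covers_sieveDomain_iff {S : Sieve p} : Covers J (sieveDomain S) p ↔ S ∈ J p := by
  rw [Covers, sieveOf_sieveDomain]

lemma le_of_covers_imp (h : ∀ D p, Covers J D p → Covers K D p) : J ≤ K :=
  fun _ _ hS ↦ covers_sieveDomain_iff.1 (h _ _ (covers_sieveDomain_iff.2 hS))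

lemma ext_of_covers (h : ∀ D p, Covers J D p ↔ Covers K D p) : J = K :=
  le_antisymm (le_of_covers_imp fun D p ↦ (h D p).1) (le_of_covers_imp fun D p ↦ (h D p).2)

lemma Covers.of_mem (h : p ∈ D) : Covers J D p :=
  J.superset_covering (S := ⊤) (fun _ f _ ↦ D.lower (leOfHom f) h) (J.top_mem p)

lemma Covers.of_le (h : Covers J D p) (hq : q ≤ p) : Covers J D q :=
  J.pullback_stable (homOfLE hq) h

lemma Covers.trans (h : Covers J D p) (h' : ∀ q ∈ D, q ≤ p → Covers J E q) : Covers J E p :=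
  J.transitive h _ fun _ f hf ↦ h' _ hf (leOfHom f)

lemma Covers.mono (h : Covers J D p) (h' : D ≤ E) : Covers J E p :=
  h.trans fun _ hq _ ↦ .of_mem (h' hq)

lemma Covers.inf (h : Covers J D p) (h' : Covers J E p) : Covers J (D ⊓ E) p :=
  J.intersection_covering h h'

/-- The topology on `P` induced by a subset `A`: a sieve on `p` is covering if it contains all
elements of `A` below `p`. Its sheaves are the presheaves on `A`. -/
def subsetTopology (A : Set P) : GrothendieckTopology P where
  sieves p := {S | ∀ a ∈ A, ∀ f : a ⟶ p, S f}
  top_mem' _ _ _ _ := trivial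
  pullback_stable' _ _ _ f h a ha g := h a ha (g ≫ f)
  transitive' p S h R h' a ha f := by
    simpa using h' (h a ha f) a ha (𝟙 a)

lemma mem_subsetTopology {A : Set P} {S : Sieve p} :
    S ∈ subsetTopology A p ↔ ∀ a ∈ A, ∀ f : a ⟶ p, S f :=
  Iff.rfl

lemma covers_subsetTopology {A : Set P} :
    Covers (subsetTopology A) D p ↔ ∀ a ∈ A, a ≤ p → a ∈ D :=
  ⟨fun h a ha hap ↦ h a ha (homOfLE hap), fun h a ha f ↦ h a ha (leOfHom f)⟩

lemma covers_Iio_subsetTopology_iff {A : Set P} :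
    Covers (subsetTopology A) (LowerSet.Iio p) p ↔ p ∉ A := by
  rw [covers_subsetTopology]
  exact ⟨fun h hp ↦ lt_irrefl p (h p hp le_rfl),
    fun hp a ha hap ↦ lt_of_le_of_ne hap fun h ↦ hp (h ▸ ha)⟩

lemma subsetTopology_injective :
    Function.Injective (subsetTopology : Set P → GrothendieckTopology P) := by
  intro A B h
  ext p
  rw [← not_iff_not, ← covers_Iio_subsetTopology_iff, h, covers_Iio_subsetTopology_iff]

/-- A topology is of finite type if every covering lower set contains a finite set whose lower
closure is still covering. -/
def IsFiniteType (J : GrothendieckTopology P) : Prop :=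
  ∀ ⦃D p⦄, Covers J D p → ∃ T : Finset P, (T : Set P) ⊆ D ∧ Covers J (lowerClosure T) p

lemma IsFiniteType.le (hJ : IsFiniteType J)
    (h : ∀ (T : Finset P) p, Covers J (lowerClosure T) p → Covers K (lowerClosure T) p) :
    J ≤ K :=
  le_of_covers_imp fun _ p hD ↦
    have ⟨T, hTD, hT⟩ := hJ hD
    (h T p hT).mono (lowerClosure_le.2 hTD)

end Topologies

/-! ### Points -/

section Points

variable {P : Type u} [PartialOrder P]

/-- The filter `F` is a point of the site `(P, J)`: it meets every lower set that covers one of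
its elements. -/
def IsPointOf (J : GrothendieckTopology P) (F : PFilter P) : Prop :=
  ∀ ⦃D p⦄, Covers J D p → p ∈ F → ∃ q ∈ F, q ∈ D

/-- The functor given by membership in `F`, which is the fiber functor of a point of every site
`(P, J)` with `IsPointOf J F`. -/
def fiberFunctor (F : PFilter P) : P ⥤ Type u where
  obj p := ULift (PLift (p ∈ F))
  map f := ↾fun x ↦ ⟨⟨PFilter.mem_of_le (leOfHom f) x.down.down⟩⟩

instance (F : PFilter P) (p : P) : Subsingleton ((fiberFunctor F).obj p) :=
  inferInstanceAs (Subsingleton (ULift (PLift _)))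

instance (F : PFilter P) : IsCofiltered (fiberFunctor F).Elements where
  nonempty :=
    have ⟨p, hp⟩ := F.nonempty
    ⟨⟨p, ⟨⟨hp⟩⟩⟩⟩
  cone_objs := by
    rintro ⟨p, x⟩ ⟨q, y⟩
    obtain ⟨r, hr, hrp, hrq⟩ := F.directed p x.down.down q y.down.down
    exact ⟨⟨r, ⟨⟨hr⟩⟩⟩, CategoryOfElements.homMk _ _ (homOfLE hrp) (Subsingleton.elim _ _),
      CategoryOfElements.homMk _ _ (homOfLE hrq) (Subsingleton.elim _ _), trivial⟩
  cone_maps X Y f g := ⟨X, 𝟙 X, CategoryOfElements.ext _ _ _ (Subsingleton.elim _ _)⟩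

variable {J K : GrothendieckTopology P}

/-- The point of the site `(P, J)` given by a filter. -/
def pointOfFilter (F : {F : PFilter P // IsPointOf J F}) : GrothendieckTopology.Point.{u} J where
  fiber := fiberFunctor F.1
  initiallySmall := initiallySmall_of_essentiallySmall _
  jointly_surjective S hS x :=
    have ⟨q, hq, f, hf⟩ := F.2 (covers_sieveDomain_iff.2 hS) x.down.down
    ⟨q, f, hf, ⟨⟨hq⟩⟩, Subsingleton.elim _ _⟩

lemma subsingleton_fiber (Φ : GrothendieckTopology.Point.{u} J) (p : P) :
    Subsingleton (Φ.fiber.obj p) where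
  allEq x y := by
    obtain ⟨Z, f, g, -⟩ := IsCofilteredOrEmpty.cone_objs (C := Φ.fiber.Elements) ⟨p, x⟩ ⟨p, y⟩
    calc
      x = Φ.fiber.map f.1 Z.2 := f.2.symm
      _ = Φ.fiber.map g.1 Z.2 := by rw [Subsingleton.elim f.1 g.1]
      _ = y := g.2

/-- The filter of those elements of `P` at which the fiber functor of a point is inhabited. -/
def filterOfPoint (Φ : GrothendieckTopology.Point.{u} J) : PFilter P :=
  IsPFilter.toPFilter (F := {p | Nonempty (Φ.fiber.obj p)}) <| by
    refine .of_def ?_ ?_ ?_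
    · obtain ⟨p, x⟩ := (IsCofiltered.nonempty : Nonempty Φ.fiber.Elements)
      exact ⟨p, ⟨x⟩⟩
    · rintro p ⟨x⟩ q ⟨y⟩
      obtain ⟨Z, f, g, -⟩ := IsCofilteredOrEmpty.cone_objs (C := Φ.fiber.Elements) ⟨p, x⟩ ⟨q, y⟩
      exact ⟨Z.1, ⟨Z.2⟩, leOfHom f.1, leOfHom g.1⟩
    · rintro p q hpq ⟨x⟩
      exact ⟨Φ.fiber.map (homOfLE hpq) x⟩

lemma isPointOf_filterOfPoint (Φ : GrothendieckTopology.Point.{u} J) :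
    IsPointOf J (filterOfPoint Φ) := by
  rintro D p hD ⟨x⟩
  obtain ⟨q, _, hq, y, -⟩ := Φ.jointly_surjective _ hD x
  exact ⟨q, ⟨y⟩, hq⟩

lemma hasEnoughPoints_iff : GrothendieckTopology.HasEnoughPoints.{u} J ↔
    ∀ D p, (∀ F, IsPointOf J F → p ∈ F → ∃ q ∈ F, q ∈ D) → Covers J D p := by
  constructor
  · rintro ⟨Q, _, hQ⟩ D p h
    have hmem := (hQ.jointly_reflect_ofArrows_mem (ι := {q : P // q ∈ D ∧ q ≤ p})
      fun q ↦ homOfLE q.2.2).2 fun Φ x ↦ by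
        obtain ⟨q, hqF, hqD⟩ := h _ (isPointOf_filterOfPoint Φ.obj) ⟨x⟩
        obtain ⟨r, ⟨y⟩, hrp, hrq⟩ := (filterOfPoint Φ.obj).directed p ⟨x⟩ q hqF
        have := subsingleton_fiber Φ.obj p
        exact ⟨⟨r, D.lower hrq hqD, hrp⟩, y, Subsingleton.elim _ _⟩
    refine J.superset_covering ?_ hmem
    rintro r f ⟨s, g, _, ⟨q⟩, -⟩
    exact D.lower (leOfHom g) q.2.1
  · refine fun h ↦ ⟨.ofObj (pointOfFilter (J := J)), inferInstance, .mk' fun p S hS ↦ ?_⟩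
    refine covers_sieveDomain_iff.1 (h _ p fun F hF hpF ↦ ?_)
    obtain ⟨q, f, hf, y, -⟩ := hS ⟨pointOfFilter ⟨F, hF⟩, ⟨_⟩⟩ ⟨⟨hpF⟩⟩
    exact ⟨q, y.down.down, f, hf⟩

lemma eq_of_isPointOf_iff (hJ : GrothendieckTopology.HasEnoughPoints.{u} J)
    (hK : GrothendieckTopology.HasEnoughPoints.{u} K)
    (h : ∀ F, IsPointOf J F ↔ IsPointOf K F) : J = K :=
  ext_of_covers fun D p ↦
    ⟨fun hD ↦ hasEnoughPoints_iff.1 hK D p fun F hF ↦ (h F).2 hF hD,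
      fun hD ↦ hasEnoughPoints_iff.1 hJ D p fun F hF ↦ (h F).1 hF hD⟩

lemma isPointOf_principal_subsetTopology {A : Set P} {a : P} (ha : a ∈ A) :
    IsPointOf (subsetTopology A) (.principal a) :=
  fun _ _ hD hp ↦ ⟨a, le_rfl, covers_subsetTopology.1 hD a ha hp⟩

lemma hasEnoughPoints_subsetTopology (A : Set P) :
    GrothendieckTopology.HasEnoughPoints.{u} (subsetTopology A) := by
  refine hasEnoughPoints_iff.2 fun D p h ↦ covers_subsetTopology.2 fun a ha hap ↦ ?_
  obtain ⟨q, haq, hqD⟩ := h _ (isPointOf_principal_subsetTopology ha) hap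
  exact D.lower haq hqD

end Points

/-! ### Topologies of finite type have enough points -/

section Deligne

variable {P : Type u} [PartialOrder P] {J : GrothendieckTopology P} {D M : LowerSet P} {p q : P}

lemma IsFiniteType.exists_mem_covers_of_covers_sSup (hJ : IsFiniteType J) {c : Set (LowerSet P)}
    (hne : c.Nonempty) (hc : IsChain (· ≤ ·) c) (h : Covers J (sSup c) p) :
    ∃ M ∈ c, Covers J M p := by
  obtain ⟨T, hTc, hT⟩ := hJ h
  rw [LowerSet.coe_sSup] at hTc
  obtain ⟨M, hM, hTM⟩ :=
    DirectedOn.exists_mem_subset_of_finset_subset_biUnion hne hc.directedOn hTc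
  exact ⟨M, hM, hT.mono (lowerClosure_le.2 hTM)⟩

lemma IsFiniteType.exists_maximal_not_covers (hJ : IsFiniteType J) (hD : ¬ Covers J D p) :
    ∃ M, D ≤ M ∧ Maximal (¬ Covers J · p) M := by
  refine zorn_le_nonempty₀ {M | ¬ Covers J M p} (fun c hcp hc y hy ↦ ⟨sSup c, fun h ↦ ?_,
    fun _ ↦ le_sSup⟩) D hD
  obtain ⟨M, hM, hMp⟩ := hJ.exists_mem_covers_of_covers_sSup ⟨y, hy⟩ hc h
  exact hcp hM hMp

lemma covers_sup_Iic_of_maximal (hM : Maximal (¬ Covers J · p) M) (hq : q ∉ M) :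
    Covers J (M ⊔ LowerSet.Iic q) p := by
  by_contra h
  exact hq (hM.le_of_ge h le_sup_left (Or.inr le_rfl))

lemma mem_of_covers_of_maximal (hM : Maximal (¬ Covers J · p) M) (hq : Covers J M q) :
    q ∈ M := by
  by_contra h
  refine hM.prop ((covers_sup_Iic_of_maximal hM h).trans ?_)
  rintro r (hr | hr) -
  exacts [.of_mem hr, hq.of_le hr]

lemma isPFilter_compl_of_maximal (hM : Maximal (¬ Covers J · p) M) :
    IsPFilter (M : Set P)ᶜ := by
  refine .of_def ⟨p, fun hp ↦ hM.prop (.of_mem hp)⟩ (fun q hq r hr ↦ ?_)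
    fun hqr hq hr ↦ hq (M.lower hqr hr)
  by_contra! h
  have hqr : LowerSet.Iic q ⊓ LowerSet.Iic r ≤ M := fun s ⟨hsq, hsr⟩ ↦
    by_contra fun hs ↦ h s hs hsq hsr
  have hcovers := (covers_sup_Iic_of_maximal hM hq).inf (covers_sup_Iic_of_maximal hM hr)
  rw [← sup_inf_left, sup_eq_left.2 hqr] at hcovers
  exact hM.prop hcovers

/-- This is Deligne's theorem for the site `(P, J)`. -/
theorem IsFiniteType.hasEnoughPoints (hJ : IsFiniteType J) :
    GrothendieckTopology.HasEnoughPoints.{u} J := by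
  refine hasEnoughPoints_iff.2 fun D p h ↦ ?_
  by_contra hD
  obtain ⟨M, hDM, hM⟩ := hJ.exists_maximal_not_covers hD
  have hpoint : IsPointOf J (isPFilter_compl_of_maximal hM).toPFilter := by
    intro E q hE hq
    by_contra! hEM
    exact hq (mem_of_covers_of_maximal hM (hE.mono fun r hr ↦ by_contra fun hrM ↦ hEM r hrM hr))
  obtain ⟨q, hqM, hqD⟩ := h _ hpoint fun hp ↦ hM.prop (.of_mem hp)
  exact hqM (hDM hqD)

end Deligne

/-! ### Compact and coherent objects under functors -/

section CompactCoherent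

variable {C : Type*} [Category.{v} C] {D : Type*} [Category.{v} D]

lemma IsEpimorphicFamily.of_factorsThru {ι κ : Type v} {A : ι → C} {B : κ → C} {E : C}
    {f : ∀ i, A i ⟶ E} {g : ∀ k, B k ⟶ E} (hf : IsEpimorphicFamily f)
    (hfg : ∀ i, ∃ k, ∃ a : A i ⟶ B k, a ≫ g k = f i) : IsEpimorphicFamily g := by
  intro Z u u' hu
  refine hf u u' fun i ↦ ?_
  obtain ⟨k, a, ha⟩ := hfg i
  rw [← ha, Category.assoc, Category.assoc, hu]

lemma IsEpimorphicFamily.comp_epi {ι : Type v} {A : ι → C} {E E' : C} {f : ∀ i, A i ⟶ E}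
    (hf : IsEpimorphicFamily f) (e : E ⟶ E') [Epi e] : IsEpimorphicFamily fun i ↦ f i ≫ e := by
  intro Z u u' hu
  rw [← cancel_epi e]
  exact hf _ _ fun i ↦ by simpa only [Category.assoc] using hu i

lemma IsEpimorphicFamily.map_leftAdjoint {ι : Type v} {A : ι → C} {E : C} {f : ∀ i, A i ⟶ E}
    (hf : IsEpimorphicFamily f) (L : C ⥤ D) [L.IsLeftAdjoint] :
    IsEpimorphicFamily fun i ↦ L.map (f i) := by
  intro Z u u' hu
  let adj := Adjunction.ofIsLeftAdjoint L
  refine (adj.homEquiv _ _).injective (hf _ _ fun i ↦ ?_)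
  rw [← adj.homEquiv_naturality_left, ← adj.homEquiv_naturality_left, hu]

lemma IsCompactObj.of_iso {E E' : C} (hE : IsCompactObj E) (e : E ≅ E') : IsCompactObj E' := by
  intro ι A f hf
  obtain ⟨s, hs⟩ := hE A _ (hf.comp_epi e.inv)
  exact ⟨s, by simpa using hs.comp_epi e.hom⟩

lemma IsCoherentObj.of_iso {E E' : C} (hE : IsCoherentObj E) (e : E ≅ E') : IsCoherentObj E' :=
  ⟨hE.1.of_iso e, fun _ _ _ f g fst snd hA hB sq ↦
    hE.2 (f ≫ e.inv) (g ≫ e.inv) fst snd hA hB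
      (sq.of_iso (.refl _) (.refl _) (.refl _) e.symm (by simp) (by simp) (by simp) (by simp))⟩

variable {L : C ⥤ D} {R : D ⥤ C}

lemma IsCompactObj.map_fullyFaithful_leftAdjoint (adj : L ⊣ R) [L.Full] [L.Faithful]
    [R.IsLeftAdjoint] {E : C} (hE : IsCompactObj E) : IsCompactObj (L.obj E) := by
  intro ι A f hf
  obtain ⟨s, hs⟩ := hE _ _ ((hf.map_leftAdjoint R).comp_epi (inv (adj.unit.app E)))
  have := adj.isLeftAdjoint
  refine ⟨s, (hs.map_leftAdjoint L).of_factorsThru fun i ↦ ⟨i, adj.counit.app _, ?_⟩⟩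
  have hcounit : adj.counit.app (L.obj E) = L.map (inv (adj.unit.app E)) := by
    rw [Functor.map_inv, ← IsIso.inv_eq_of_hom_inv_id (adj.left_triangle_components E)]
  rw [L.map_comp, ← hcounit, ← Functor.comp_map, adj.counit.naturality, Functor.id_map]

lemma IsCoherentObj.map_rightAdjoint (adj : L ⊣ R) [L.Full] [L.Faithful] [R.IsLeftAdjoint]
    [HasPullbacks D] (hR : ∀ E : D, IsCompactObj E → IsCompactObj (R.obj E)) {E : D}
    (hE : IsCoherentObj E) : IsCoherentObj (R.obj E) := by
  refine ⟨hR E hE.1, fun E' E'' Q f g fst snd hE' hE'' sq ↦ ?_⟩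
  let f' := (adj.homEquiv _ _).symm f
  let g' := (adj.homEquiv _ _).symm g
  have hQ : IsCompactObj (pullback f' g') :=
    hE.2 f' g' _ _ (hE'.map_fullyFaithful_leftAdjoint adj)
      (hE''.map_fullyFaithful_leftAdjoint adj) (.of_hasPullback f' g')
  have := adj.isRightAdjoint
  have transpose {A : C} (a : A ⟶ R.obj E) :
      adj.unit.app A ≫ R.map ((adj.homEquiv _ _).symm a) = a :=
    (adj.unit_comp_map_eq_iff _ a).2 (adj.homEquiv_counit _ _ a)
  have sq' : IsPullback (R.map (pullback.fst f' g') ≫ inv (adj.unit.app E'))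
      (R.map (pullback.snd f' g') ≫ inv (adj.unit.app E'')) f g :=
    ((IsPullback.of_hasPullback f' g').map R).of_iso (.refl _) (asIso (adj.unit.app E')).symm
      (asIso (adj.unit.app E'')).symm (.refl _) (by simp) (by simp)
      (by simpa [f'] using transpose f) (by simpa [g'] using transpose g)
  exact (hR _ hQ).of_iso (sq'.isoIsPullback _ _ sq)

lemma IsCoherentObj.map_equivalence (e : C ≌ D) [HasPullbacks C] {E : C} (hE : IsCoherentObj E) :
    IsCoherentObj (e.functor.obj E) :=
  hE.map_rightAdjoint e.symm.toAdjunction fun _ hE ↦ hE.map_fullyFaithful_leftAdjoint e.toAdjunction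

lemma IsCoherentTopos.of_equivalence (e : C ≌ D) (hC : IsCoherentTopos C) :
    IsCoherentTopos D := by
  obtain ⟨K, hcompact, hsep, hlim⟩ := hC
  have : K.IsClosedUnderIsomorphisms := ⟨fun i hX ↦ K.limitsOfShape_le (Discrete Unit) _
    ((K.limitsOfShape _).prop_of_iso i ⟨⟨⟨_, _, isLimitConstCone _ _⟩, fun _ ↦ hX⟩⟩)⟩
  refine ⟨K.inverseImage e.inverse, fun E hE ↦ ?_, ?_, fun I _ _ ↦ inferInstance⟩
  · exact ((hcompact _ hE).map_fullyFaithful_leftAdjoint e.toAdjunction).of_iso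
      (e.counitIso.app E)
  · refine (hsep.of_equivalence e).of_le ?_
    rintro _ ⟨E, hE⟩
    exact K.prop_of_iso (e.unitIso.app E) hE

end CompactCoherent

/-! ### Compact presheaves -/

section Presheaves

variable {C : Type u} [SmallCategory C] {F : Cᵒᵖ ⥤ Type u}

lemma isEpimorphicFamily_iff_jointly_surjective {ι : Type u} {A : ι → Cᵒᵖ ⥤ Type u}
    {f : ∀ i, A i ⟶ F} :
    IsEpimorphicFamily f ↔ ∀ p (x : F.obj p), ∃ i y, (f i).app p y = x := by
  constructor
  · intro hf p x
    let G := ⨆ i, Subfunctor.range (f i)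
    have : Epi G.ι := ⟨fun g h hgh ↦ hf g h fun i ↦ by
      rw [← Subfunctor.lift_ι (f i) (le_iSup (fun i ↦ Subfunctor.range (f i)) i),
        Category.assoc, Category.assoc, hgh]⟩
    have hG : G = ⊤ := by rw [← Subfunctor.range_eq_top G.ι, Subfunctor.range_ι]
    have hx : x ∈ G.obj p := hG ▸ trivial
    simpa [G] using hx
  · intro hf Z g h hgh
    ext p x
    obtain ⟨i, y, rfl⟩ := hf p x
    exact ConcreteCategory.congr_hom (NatTrans.congr_app (hgh i) p) y

lemma presheafIsGeneratedBy_iff {ι : Type*} {X : ι → Cᵒᵖ} {x : ∀ i, F.obj (X i)} :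
    PresheafIsGeneratedBy F x ↔
      ∀ p (y : F.obj p), ∃ i, ∃ g : X i ⟶ p, F.map g (x i) = y := by
  simp [Subfunctor.isGeneratedBy_iff, Subfunctor.ext_iff, funext_iff, Set.eq_univ_iff_forall,
    Subfunctor.ofSection]

lemma isCompactObj_iff_presheafIsFinite : IsCompactObj F ↔ PresheafIsFinite F := by
  constructor
  · intro hF
    obtain ⟨s, hs⟩ := hF (fun x : Σ p, F.obj p ↦ yoneda.obj x.1.unop)
      (fun x ↦ yonedaEquiv.symm x.2) (isEpimorphicFamily_iff_jointly_surjective.2 fun p x ↦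
        ⟨⟨p, x⟩, 𝟙 _, yonedaEquiv.apply_symm_apply x⟩)
    have hgen : PresheafIsGeneratedBy F fun t : s ↦ t.1.2 :=
      presheafIsGeneratedBy_iff.2 fun p x ↦ by
        obtain ⟨t, g, rfl⟩ := isEpimorphicFamily_iff_jointly_surjective.1 hs p x
        exact ⟨t, g.op, rfl⟩
    exact hgen.isFinite
  · rintro ⟨κ, _, X, x, ⟨hgen⟩⟩ ι A f hf
    rw [isEpimorphicFamily_iff_jointly_surjective] at hf
    choose i y hy using fun j ↦ hf (X j) (x j)
    refine ⟨(Set.finite_range i).toFinset, isEpimorphicFamily_iff_jointly_surjective.2 ?_⟩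
    intro p z
    obtain ⟨j, g, rfl⟩ := presheafIsGeneratedBy_iff.1 hgen p z
    refine ⟨⟨i j, by simp⟩, (A (i j)).map g (y j), ?_⟩
    rw [NatTrans.naturality_apply, hy]

end Presheaves

/-! ### Finitely generated lower sets and compact presheaves on a poset -/

section PosetPresheaves

variable {P : Type u} [PartialOrder P]

/-- A lower set is finitely generated if it is the lower closure of a finite set. -/
def IsFinitelyGenerated (S : Set P) : Prop :=
  ∃ T : Set P, T.Finite ∧ (lowerClosure T : Set P) = S

lemma IsFinitelyGenerated.preimage_coe {S : Set P} (hS : IsFinitelyGenerated S)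
    (A : UpperSet P) : IsFinitelyGenerated ((↑) ⁻¹' S : Set A) := by
  obtain ⟨T, hT, rfl⟩ := hS
  refine ⟨(↑) ⁻¹' T, hT.preimage Subtype.val_injective.injOn, ?_⟩
  ext a
  exact ⟨fun ⟨t, ht, hat⟩ ↦ ⟨t, ht, hat⟩, fun ⟨t, ht, hat⟩ ↦ ⟨⟨t, A.upper hat a.2⟩, ht, hat⟩⟩

lemma IsFinitelyGenerated.inter (hinf : ∀ p q : P, IsFinitelyGenerated (Set.Iic p ∩ Set.Iic q))
    {S S' : Set P} (hS : IsFinitelyGenerated S) (hS' : IsFinitelyGenerated S') :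
    IsFinitelyGenerated (S ∩ S') := by
  obtain ⟨T, hT, rfl⟩ := hS
  obtain ⟨T', hT', rfl⟩ := hS'
  choose R hR hR' using hinf
  refine ⟨⋃ t ∈ T, ⋃ t' ∈ T', R t t', hT.biUnion fun t _ ↦ hT'.biUnion fun t' _ ↦ hR t t', ?_⟩
  simp only [lowerClosure_iUnion, LowerSet.coe_iSup, hR', coe_lowerClosure, Set.iUnion₂_inter,
    Set.inter_iUnion₂]
  exact Set.iUnion₂_comm _

lemma IsFinitelyGenerated.iInter (htop : IsFinitelyGenerated (Set.univ : Set P))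
    (hinf : ∀ p q : P, IsFinitelyGenerated (Set.Iic p ∩ Set.Iic q)) {ι : Type*} [Finite ι]
    {S : ι → Set P} (hS : ∀ i, IsFinitelyGenerated (S i)) : IsFinitelyGenerated (⋂ i, S i) := by
  rw [← Set.sInter_range]
  refine Set.Finite.induction_on_subset _ (Set.finite_range S) (by simpa using htop) ?_
  rintro _ s ⟨i, rfl⟩ - - hs
  rw [Set.sInter_insert]
  exact (hS i).inter hinf hs

variable {F : Pᵒᵖ ⥤ Type u}

/-- The lower set of the elements of `P` over which `F` has a section. -/
def presheafSupport (F : Pᵒᵖ ⥤ Type u) : Set P := {p | Nonempty (F.obj (op p))}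

lemma presheafIsFinite_iff_of_subsingleton [∀ p, Subsingleton (F.obj p)] :
    PresheafIsFinite F ↔ IsFinitelyGenerated (presheafSupport F) := by
  constructor
  · rintro ⟨κ, _, X, x, ⟨hgen⟩⟩
    refine ⟨Set.range fun i ↦ (X i).unop, Set.finite_range _, Set.ext fun p ↦ ⟨?_, ?_⟩⟩
    · rintro ⟨_, ⟨i, rfl⟩, hp⟩
      exact ⟨F.map (homOfLE hp).op (x i)⟩
    · rintro ⟨y⟩
      obtain ⟨i, g, -⟩ := presheafIsGeneratedBy_iff.1 hgen _ y
      exact ⟨_, ⟨i, rfl⟩, leOfHom g.unop⟩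
  · rintro ⟨T, hT, hTF⟩
    have := hT.to_subtype
    have hne (t : T) : t.1 ∈ presheafSupport F := hTF ▸ subset_lowerClosure t.2
    have hgen : PresheafIsGeneratedBy F fun t : T ↦ (hne t).some :=
      presheafIsGeneratedBy_iff.2 fun p y ↦ by
        obtain ⟨t, ht, hpt⟩ := hTF.ge (show p.unop ∈ presheafSupport F from ⟨y⟩)
        exact ⟨⟨t, ht⟩, (homOfLE hpt).op, Subsingleton.elim _ _⟩
    exact hgen.isFinite

lemma presheafIsFinite_of_isPullback
    (hinf : ∀ p q : P, IsFinitelyGenerated (Set.Iic p ∩ Set.Iic q))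
    [∀ p, Subsingleton (F.obj p)] {G H Q : Pᵒᵖ ⥤ Type u} [hG : PresheafIsFinite G]
    [hH : PresheafIsFinite H] {fst : Q ⟶ G} {snd : Q ⟶ H} {g : G ⟶ F} {h : H ⟶ F}
    (sq : IsPullback fst snd g h) : PresheafIsFinite Q := by
  obtain ⟨ι, _, X, x, ⟨hx⟩⟩ := hG.exists_isGeneratedBy
  obtain ⟨κ, _, Y, y, ⟨hy⟩⟩ := hH.exists_isGeneratedBy
  choose T hT hTXY using fun (i : ι) (j : κ) ↦ hinf (X i).unop (Y j).unop
  have (i : ι) (j : κ) := (hT i j).to_subtype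
  have sq_app (p : Pᵒᵖ) := sq.map ((evaluation _ _).obj p)
  have exists_section (t : Σ i j, T i j) :
      ∃ (z : Q.obj (op t.2.2)) (a : X t.1 ⟶ op t.2.2) (b : Y t.2.1 ⟶ op t.2.2),
        fst.app _ z = G.map a (x t.1) ∧ snd.app _ z = H.map b (y t.2.1) := by
    have ht := hTXY t.1 t.2.1 ▸ subset_lowerClosure t.2.2.2
    obtain ⟨z, hz⟩ := Types.exists_of_isPullback (sq_app (op t.2.2))
      (G.map (homOfLE ht.1).op (x t.1)) (H.map (homOfLE ht.2).op (y t.2.1))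
      (Subsingleton.elim (α := F.obj _) _ _)
    exact ⟨z, _, _, hz⟩
  choose z a b hza hzb using exists_section
  have hgen : PresheafIsGeneratedBy Q z := presheafIsGeneratedBy_iff.2 fun p q ↦ by
    obtain ⟨i, c, hc⟩ := presheafIsGeneratedBy_iff.1 hx p (fst.app p q)
    obtain ⟨j, d, hd⟩ := presheafIsGeneratedBy_iff.1 hy p (snd.app p q)
    obtain ⟨t, ht, hpt⟩ := (hTXY i j).ge ⟨leOfHom c.unop, leOfHom d.unop⟩
    let t' : Σ i j, T i j := ⟨i, j, t, ht⟩
    let r : op (t'.2.2 : P) ⟶ p := (homOfLE hpt).op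
    refine ⟨t', r, Types.ext_of_isPullback (sq_app p) ?_ ?_⟩
    · change fst.app p (Q.map r (z t')) = fst.app p q
      rw [NatTrans.naturality_apply, hza, ← hc, ← Functor.map_comp_apply,
        Subsingleton.elim c (a t' ≫ r)]
    · change snd.app p (Q.map r (z t')) = snd.app p q
      rw [NatTrans.naturality_apply, hzb, ← hd, ← Functor.map_comp_apply,
        Subsingleton.elim d (b t' ≫ r)]
  exact hgen.isFinite

lemma isCoherentObj_of_subsingleton [PresheafIsFinite F] [∀ p, Subsingleton (F.obj p)]
    (hinf : ∀ p q : P, IsFinitelyGenerated (Set.Iic p ∩ Set.Iic q)) : IsCoherentObj F := by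
  refine ⟨isCompactObj_iff_presheafIsFinite.2 ‹_›, fun E' E'' Q f g fst snd hE' hE'' sq ↦ ?_⟩
  rw [isCompactObj_iff_presheafIsFinite] at hE' hE'' ⊢
  exact presheafIsFinite_of_isPullback hinf sq

section Limits

variable {I : Type*} [SmallCategory I] {G : I ⥤ Pᵒᵖ ⥤ Type u}
  [∀ i p, Subsingleton ((G.obj i).obj p)] {c : Cone G}

lemma subsingleton_of_isLimit (hc : IsLimit c) (p : Pᵒᵖ) : Subsingleton (c.pt.obj p) :=
  ⟨fun x y ↦ Concrete.isLimit_ext _ (isLimitOfPreserves ((evaluation _ _).obj p) hc) x y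
    fun i ↦ Subsingleton.elim (α := (G.obj i).obj p) _ _⟩

lemma presheafSupport_of_isLimit (hc : IsLimit c) :
    presheafSupport c.pt = ⋂ i, presheafSupport (G.obj i) := by
  ext p
  refine ⟨fun ⟨x⟩ ↦ Set.mem_iInter.2 fun i ↦ ⟨(c.π.app i).app _ x⟩, fun hp ↦ ?_⟩
  have hlim := (Types.isLimit_iff _).1
    ⟨isLimitOfPreserves ((evaluation _ (Type u)).obj (op p)) hc⟩
  obtain ⟨x, -⟩ := hlim (fun i ↦ (Set.mem_iInter.1 hp i).some)
    fun {i j} _ ↦ Subsingleton.elim (α := (G.obj j).obj (op p)) _ _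
  exact ⟨x⟩

end Limits

lemma isCoherentTopos_presheaf (htop : IsFinitelyGenerated (Set.univ : Set P))
    (hinf : ∀ p q : P, IsFinitelyGenerated (Set.Iic p ∩ Set.Iic q)) :
    IsCoherentTopos (Pᵒᵖ ⥤ Type u) := by
  refine ⟨fun F ↦ PresheafIsFinite F ∧ ∀ p, Subsingleton (F.obj p),
    fun F hF ↦ isCompactObj_iff_presheafIsFinite.2 hF.1, fun F G g h hgh ↦ ?_, fun I _ _ ↦ ⟨?_⟩⟩
  · ext p x
    have hx := hgh (yoneda.obj p.unop) ⟨inferInstance, fun q ↦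
      inferInstanceAs (Subsingleton (q.unop ⟶ p.unop))⟩ (yonedaEquiv.symm x)
    have hx_id := ConcreteCategory.congr_hom (NatTrans.congr_app hx p) (𝟙 p.unop)
    rwa [NatTrans.comp_app_apply, NatTrans.comp_app_apply,
      show (yonedaEquiv.symm x).app p (𝟙 p.unop) = x from yonedaEquiv.apply_symm_apply x] at hx_id
  · rintro F ⟨hF⟩
    have hsub (d : I) := (hF.prop_diag_obj d).2
    have := subsingleton_of_isLimit hF.isLimit
    refine ⟨?_, this⟩
    rw [presheafIsFinite_iff_of_subsingleton, presheafSupport_of_isLimit hF.isLimit]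
    exact .iInter htop hinf fun d ↦ presheafIsFinite_iff_of_subsingleton.1 (hF.prop_diag_obj d).1

end PosetPresheaves

/-! ### The space of filters -/

section Filters

variable {P : Type u} [PartialOrder P]

/-- The Scott open set of the filters that contain `p`. -/
def basicOpen (p : P) : Set (PFilter P) := {F | p ∈ F}

lemma principal_mem_basicOpen_iff {p q : P} : PFilter.principal q ∈ basicOpen p ↔ q ≤ p :=
  Iff.rfl

/-- The union of a nonempty directed set of filters. -/
def directedUnion {d : Set (PFilter P)} (hne : d.Nonempty) (hd : DirectedOn (· ≤ ·) d) :
    PFilter P :=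
  IsPFilter.toPFilter (F := ⋃ F ∈ d, (F : Set P)) <| by
    refine .of_def ?_ (fun p hp q hq ↦ ?_) fun hpq hp ↦ ?_
    · obtain ⟨F, hF⟩ := hne
      exact F.nonempty.mono (Set.subset_biUnion_of_mem hF)
    · obtain ⟨F, hF, hpF⟩ := Set.mem_iUnion₂.1 hp
      obtain ⟨G, hG, hqG⟩ := Set.mem_iUnion₂.1 hq
      obtain ⟨H, hH, hFH, hGH⟩ := hd F hF G hG
      obtain ⟨r, hr, hrp, hrq⟩ := H.directed p (hFH hpF) q (hGH hqG)
      exact ⟨r, Set.mem_biUnion hH hr, hrp, hrq⟩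
    · obtain ⟨F, hF, hpF⟩ := Set.mem_iUnion₂.1 hp
      exact Set.mem_biUnion hF (PFilter.mem_of_le hpq hpF)

lemma isOpen_basicOpen (p : P) : IsOpen (basicOpen p) := by
  rw [Topology.IsScott.isOpen_iff_isUpperSet_and_dirSupInaccOn (D := Set.univ)]
  refine ⟨fun F G hFG hF ↦ hFG hF, fun d _ hne hd F hF hpF ↦ ?_⟩
  have hle : F ≤ directedUnion hne hd := hF.2 fun G hG q hq ↦ Set.mem_biUnion hG hq
  obtain ⟨G, hG, hp⟩ := Set.mem_iUnion₂.1 (hle hpF)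
  exact ⟨G, hG, hp⟩

lemma isCompact_basicOpen (p : P) : IsCompact (basicOpen p) := by
  refine isCompact_of_finite_subcover fun V hV hpV ↦ ?_
  obtain ⟨i, hi⟩ := Set.mem_iUnion.1 (hpV (principal_mem_basicOpen_iff.2 (le_refl p)))
  have hupper := Topology.IsScott.isUpperSet_of_isOpen (D := Set.univ) (hV i)
  exact ⟨{i}, fun F hF ↦ Set.mem_biUnion (Finset.mem_singleton_self i)
    (hupper (PFilter.principal_le_iff.2 hF) hi)⟩

lemma isFinitelyGenerated_of_isCompact {D : Set P} (hD : IsLowerSet D)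
    (h : IsCompact (⋃ p ∈ D, basicOpen p)) : IsFinitelyGenerated D := by
  obtain ⟨T, hTD, hT, hcover⟩ :=
    h.elim_finite_subcover_image (fun p _ ↦ isOpen_basicOpen p) subset_rfl
  refine ⟨T, hT, (lowerClosure_min hTD hD).antisymm fun r hr ↦ ?_⟩
  obtain ⟨t, ht, hrt⟩ := Set.mem_iUnion₂.1
    (hcover (Set.mem_biUnion hr (principal_mem_basicOpen_iff.2 le_rfl)))
  exact ⟨t, ht, hrt⟩

lemma isFinitelyGenerated_univ [CompactSpace (PFilter P)] :
    IsFinitelyGenerated (Set.univ : Set P) := by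
  refine isFinitelyGenerated_of_isCompact isLowerSet_univ ?_
  convert isCompact_univ (X := PFilter P)
  refine Set.eq_univ_of_forall fun F ↦ ?_
  obtain ⟨p, hp⟩ := F.nonempty
  exact Set.mem_biUnion (Set.mem_univ p) hp

lemma basicOpen_inter_basicOpen (p q : P) :
    basicOpen p ∩ basicOpen q = ⋃ r ∈ Set.Iic p ∩ Set.Iic q, basicOpen r := by
  ext F
  rw [Set.mem_iUnion₂]
  constructor
  · rintro ⟨hp, hq⟩
    obtain ⟨r, hr, hrp, hrq⟩ := F.directed p hp q hq
    exact ⟨r, ⟨hrp, hrq⟩, hr⟩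
  · rintro ⟨r, ⟨hrp, hrq⟩, hr⟩
    exact ⟨PFilter.mem_of_le hrp hr, PFilter.mem_of_le hrq hr⟩

lemma isFinitelyGenerated_Iic_inter_Iic [QuasiSeparatedSpace (PFilter P)] (p q : P) :
    IsFinitelyGenerated (Set.Iic p ∩ Set.Iic q) := by
  refine isFinitelyGenerated_of_isCompact ((isLowerSet_Iic p).inter (isLowerSet_Iic q)) ?_
  rw [← basicOpen_inter_basicOpen]
  exact QuasiSeparatedSpace.inter_isCompact _ _ (isOpen_basicOpen p) (isCompact_basicOpen p)
    (isOpen_basicOpen q) (isCompact_basicOpen q)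

end Filters

/-! ### Closed subtoposes -/

section Closed

variable {P : Type u} [PartialOrder P]

lemma isSheaf_subsetTopology_iff {A : UpperSet P} {F : Pᵒᵖ ⥤ Type u} :
    Presheaf.IsSheaf (subsetTopology (A : Set P)) F ↔
      ∀ p ∉ A, Nonempty (Unique (F.obj (op p))) := by
  rw [isSheaf_iff_isSheaf_of_type]
  constructor
  · intro h p hp
    have hbot : (⊥ : Sieve p) ∈ subsetTopology (A : Set P) p :=
      fun a ha f ↦ hp (A.upper (leOfHom f) ha)
    obtain ⟨x, -, hx⟩ := h ⊥ hbot (fun _ _ hf ↦ hf.elim) (fun _ _ _ _ _ _ _ hf ↦ hf.elim)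
    exact ⟨⟨⟨x⟩, fun y ↦ hx y fun _ _ hf ↦ hf.elim⟩⟩
  · intro h p S hS
    by_cases hp : p ∈ A
    · rw [Sieve.id_mem_iff_eq_top.1 (hS p hp (𝟙 p))]
      exact Presieve.isSheafFor_top F
    · intro x _
      obtain ⟨y⟩ := h p hp
      refine ⟨y.default, fun q f hf ↦ ?_, fun z _ ↦ Subsingleton.elim _ _⟩
      obtain ⟨_⟩ := h q fun hq ↦ hp (A.upper (leOfHom f) hq)
      exact Subsingleton.elim _ _

lemma isIso_prod_snd_iff {F U : Pᵒᵖ ⥤ Type u} [∀ p, Subsingleton (U.obj p)] :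
    IsIso (prod.snd : F ⨯ U ⟶ U) ↔ ∀ p ∈ presheafSupport U, Nonempty (Unique (F.obj (op p))) := by
  rw [NatTrans.isIso_iff_isIso_app]
  refine ⟨fun h p ⟨u⟩ ↦ ?_, fun h p ↦ ?_⟩
  · have hbij := (isIso_iff_bijective _).1 (h (op p))
    obtain ⟨z, -⟩ := hbij.2 u
    refine ⟨⟨⟨(prod.fst : F ⨯ U ⟶ F).app _ z⟩, fun x ↦ ?_⟩⟩
    have hxu : FunctorToTypes.prodMk x u = z := hbij.1 (Subsingleton.elim _ _)
    rw [← hxu]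
    exact (FunctorToTypes.prodMk_fst x u).symm
  · rw [isIso_iff_bijective]
    refine ⟨fun z z' _ ↦ ?_, fun u ↦ ?_⟩
    · obtain ⟨_⟩ := h p.unop ⟨(prod.snd : F ⨯ U ⟶ U).app _ z⟩
      apply (FunctorToTypes.binaryProductEquiv F U p).injective
      exact Prod.ext (Subsingleton.elim (α := F.obj (op p.unop)) _ _) (Subsingleton.elim _ _)
    · obtain ⟨x⟩ := h p.unop ⟨u⟩
      exact ⟨FunctorToTypes.prodMk x.default u, Subsingleton.elim _ _⟩

lemma subsingleton_of_isSubterminal {U : Pᵒᵖ ⥤ Type u} (hU : IsSubterminal U) (p : Pᵒᵖ) :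
    Subsingleton (U.obj p) where
  allEq x y := yonedaEquiv.symm.injective (hU (yonedaEquiv.symm x) (yonedaEquiv.symm y))

/-- The subterminal presheaf with a (unique) section exactly over the elements of `D`. -/
def subterminalPresheaf (D : LowerSet P) : Pᵒᵖ ⥤ Type u where
  obj p := ULift (PLift (p.unop ∈ D))
  map f := ↾fun h ↦ ⟨⟨D.lower (leOfHom f.unop) h.down.down⟩⟩

instance (D : LowerSet P) (p : Pᵒᵖ) : Subsingleton ((subterminalPresheaf D).obj p) :=
  inferInstanceAs (Subsingleton (ULift (PLift _)))

lemma isSubterminal_subterminalPresheaf (D : LowerSet P) : IsSubterminal (subterminalPresheaf D) :=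
  fun Z f g ↦ by
    ext p x
    exact Subsingleton.elim _ _

lemma presheafSupport_subterminalPresheaf (D : LowerSet P) :
    presheafSupport (subterminalPresheaf D) = D :=
  Set.ext fun _ ↦ ⟨fun ⟨h⟩ ↦ h.down.down, fun h ↦ ⟨⟨⟨h⟩⟩⟩⟩

lemma isLowerSet_presheafSupport (F : Pᵒᵖ ⥤ Type u) : IsLowerSet (presheafSupport F) :=
  fun _ _ hqp ⟨x⟩ ↦ ⟨F.map (homOfLE hqp).op x⟩

lemma isClosedSubtopos_iff {J : GrothendieckTopology P} :
    IsClosedSubtopos J ↔ ∃ A : UpperSet P, J = subsetTopology A := by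
  constructor
  · rintro ⟨U, hU, h⟩
    have := subsingleton_of_isSubterminal hU
    refine ⟨⟨_, (isLowerSet_presheafSupport U).compl⟩, topology_eq_iff_same_sheaves.2 fun F ↦ ?_⟩
    rw [← isSheaf_iff_isSheaf_of_type, ← isSheaf_iff_isSheaf_of_type, h, isIso_prod_snd_iff,
      isSheaf_subsetTopology_iff]
    exact forall_congr' fun p ↦ imp_congr_left not_not.symm
  · rintro ⟨A, rfl⟩
    refine ⟨subterminalPresheaf A.compl, isSubterminal_subterminalPresheaf _, fun F ↦ ?_⟩
    rw [isSheaf_subsetTopology_iff, isIso_prod_snd_iff, presheafSupport_subterminalPresheaf]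
    rfl

end Closed

/-! ### Sheaves for the topology induced by a subset -/

section SubsetTopology

variable {P : Type u} [PartialOrder P] (A : Set P)

/-- The inclusion of a subset of `P`, as a functor. -/
abbrev inclusion : A ⥤ P := (Subtype.mono_coe (· ∈ A)).functor

instance : (inclusion A).Full := ⟨fun f ↦ ⟨homOfLE (leOfHom f), Subsingleton.elim _ _⟩⟩

instance : (inclusion A).Faithful := ⟨fun _ ↦ Subsingleton.elim _ _⟩

instance : (inclusion A).IsCoverDense (subsetTopology A) :=
  ⟨fun _ a ha f ↦ ⟨⟨⟨a, ha⟩, 𝟙 a, f, by simp⟩⟩⟩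

instance : (inclusion A).IsDenseSubsite ⊥ (subsetTopology A) where
  functorPushforward_mem_iff {a S} := by
    rw [GrothendieckTopology.bot_covering, mem_subsetTopology]
    constructor
    · intro h
      obtain ⟨b, f, g, hf, -⟩ := h a a.2 (𝟙 _)
      exact Sieve.id_mem_iff_eq_top.1 (S.downward_closed hf (homOfLE (leOfHom g)))
    · rintro rfl b hb f
      exact ⟨⟨b, hb⟩, homOfLE (leOfHom f), 𝟙 _, trivial, Subsingleton.elim _ _⟩

/-- The sheaves for `subsetTopology A` are the presheaves on `A`. -/
noncomputable def sheafEquivPresheaf : Sheaf (subsetTopology A) (Type u) ≌ Aᵒᵖ ⥤ Type u :=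
  (Functor.IsDenseSubsite.sheafEquiv ⊥ _ (inclusion A) _).symm.trans (sheafBotEquivalence _)

/-- The restriction of presheaves on `P` to a subset. -/
abbrev restriction : (Pᵒᵖ ⥤ Type u) ⥤ (Aᵒᵖ ⥤ Type u) :=
  (Functor.whiskeringLeft _ _ _).obj (inclusion A).op

/-- Under `sheafEquivPresheaf`, sheafification is the restriction to `A`. -/
noncomputable def sheafEquivPresheafObjIso (F : Pᵒᵖ ⥤ Type u) :
    (sheafEquivPresheaf A).functor.obj ((presheafToSheaf _ _).obj F) ≅ (restriction A).obj F :=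
  (sheafToPresheaf _ _).mapIso
    ((Functor.IsDenseSubsite.sheafEquivSheafificationCompatibility ⊥ _ (inclusion A) _).app F).symm
    ≪≫ (isoSheafify ⊥ (Presheaf.isSheaf_bot _)).symm

variable {A}

lemma presheafIsFinite_restriction (hA : IsUpperSet A) {F : Pᵒᵖ ⥤ Type u}
    [hF : PresheafIsFinite F] : PresheafIsFinite ((restriction A).obj F) := by
  obtain ⟨ι, _, X, x, ⟨hx⟩⟩ := hF.exists_isGeneratedBy
  have hgen : PresheafIsGeneratedBy ((restriction A).obj F)
      (X := fun i : {i // (X i).unop ∈ A} ↦ op ⟨(X i).unop, i.2⟩) (fun i ↦ x i) :=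
    presheafIsGeneratedBy_iff.2 fun a y ↦ by
      obtain ⟨i, f, hf⟩ := presheafIsGeneratedBy_iff.1 hx _ y
      have hi : (X i).unop ∈ A := hA (leOfHom f.unop) a.unop.2
      exact ⟨⟨i, hi⟩, (homOfLE (leOfHom f.unop)).op, hf⟩
  exact hgen.isFinite

lemma IsCoherentObj.restriction (hA : IsUpperSet A) {F : Pᵒᵖ ⥤ Type u} (hF : IsCoherentObj F) :
    IsCoherentObj ((restriction A).obj F) := by
  have := ((inclusion A).op.ranAdjunction (Type u)).isLeftAdjoint
  have lan_ff := ((inclusion A).op.lanAdjunction (Type u)).fullyFaithfulLOfIsIsoUnit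
  have := lan_ff.full
  have := lan_ff.faithful
  refine hF.map_rightAdjoint ((inclusion A).op.lanAdjunction _) fun E hE ↦ ?_
  rw [isCompactObj_iff_presheafIsFinite] at hE ⊢
  exact presheafIsFinite_restriction hA

lemma isCoherentSubtopos_subsetTopology (htop : IsFinitelyGenerated (Set.univ : Set P))
    (hinf : ∀ p q : P, IsFinitelyGenerated (Set.Iic p ∩ Set.Iic q)) (A : UpperSet P) :
    IsCoherentSubtopos (subsetTopology (A : Set P)) := by
  let e := sheafEquivPresheaf (A : Set P)
  refine ⟨(isCoherentTopos_presheaf (htop.preimage_coe A)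
    fun p q ↦ (hinf p q).preimage_coe A).of_equivalence e.symm, fun F hF ↦ ?_⟩
  have := (hF.restriction A.upper).of_iso (sheafEquivPresheafObjIso (A : Set P) F).symm
  exact (this.map_equivalence e.symm).of_iso (e.unitIso.app _).symm

end SubsetTopology

/-! ### Coherent subtoposes are of finite type -/

section FiniteType

variable {C : Type u} [SmallCategory C] {J : GrothendieckTopology C} {X : C} {ι : Type u}
  {Y : ι → C} {f : ∀ i, Y i ⟶ X}

lemma isEpimorphicFamily_presheafToSheaf_yoneda_iff_forall_sheaf :
    IsEpimorphicFamily (fun i ↦ (presheafToSheaf J (Type u)).map (yoneda.map (f i))) ↔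
      ∀ (Z : Sheaf J (Type u)) (s t : Z.obj.obj (op X)),
        (∀ i, Z.obj.map (f i).op s = Z.obj.map (f i).op t) → s = t := by
  let e (U : C) (Z : Sheaf J (Type u)) :
      ((presheafToSheaf J (Type u)).obj (yoneda.obj U) ⟶ Z) ≃ Z.obj.obj (op U) :=
    ((sheafificationAdjunction J (Type u)).homEquiv _ _).trans yonedaEquiv
  have e_naturality {U V : C} (k : V ⟶ U) (Z : Sheaf J (Type u)) (g : _ ⟶ Z) :
      e V Z ((presheafToSheaf J (Type u)).map (yoneda.map k) ≫ g) = Z.obj.map k.op (e U Z g) := by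
    simp only [e, Equiv.trans_apply, Adjunction.homEquiv_naturality_left]
    exact (yonedaEquiv_naturality _ k).symm
  refine forall_congr' fun Z ↦ (e X Z).forall_congr fun g ↦ (e X Z).forall_congr fun h ↦
    imp_congr (forall_congr' fun i ↦ ?_) (e X Z).injective.eq_iff.symm
  rw [← e_naturality, ← e_naturality, (e _ _).injective.eq_iff]

lemma isEpimorphicFamily_presheafToSheaf_yoneda_iff :
    IsEpimorphicFamily (fun i ↦ (presheafToSheaf J (Type u)).map (yoneda.map (f i))) ↔
      Sieve.ofArrows Y f ∈ J X := by
  rw [isEpimorphicFamily_presheafToSheaf_yoneda_iff_forall_sheaf]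
  constructor
  · intro h
    let Ω : Sheaf J (Type u) := ⟨(Functor.closedSieves J).toFunctor,
      (isSheaf_iff_isSheaf_of_type _ _).2 (classifier_isSheaf J)⟩
    let S : Ω.obj.obj (op X) := ⟨J.close (.ofArrows Y f), J.close_isClosed _⟩
    let top : Ω.obj.obj (op X) := ⟨(⊤ : Sieve X), fun _ _ _ ↦ trivial⟩
    have hS : S = top := h Ω S top fun i ↦ Subtype.ext <| by
      change (J.close _).pullback _ = (⊤ : Sieve X).pullback _
      rw [Sieve.pullback_top]
      exact Sieve.pullback_eq_top_of_mem _ (J.le_close _ _ (Sieve.ofArrows_mk Y f i))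
    exact (J.close_eq_top_iff_mem _).1 (congrArg Subtype.val hS)
  · intro h Z s t hst
    refine (((isSheaf_iff_isSheaf_of_type _ _).1 Z.property).isSeparated _ h).ext ?_
    rintro V k ⟨_, g, _, ⟨i⟩, rfl⟩
    simp [hst]

variable {P : Type u} [PartialOrder P] [QuasiSeparatedSpace (PFilter P)]

lemma isCoherentObj_yoneda (p : P) : IsCoherentObj (yoneda.obj p) :=
  have (q : Pᵒᵖ) : Subsingleton ((yoneda.obj p).obj q) :=
    inferInstanceAs (Subsingleton (q.unop ⟶ p))
  isCoherentObj_of_subsingleton isFinitelyGenerated_Iic_inter_Iic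

lemma IsCoherentSubtopos.isFiniteType {J : GrothendieckTopology P} (hJ : IsCoherentSubtopos J) :
    IsFiniteType J := by
  intro D p hD
  let f (q : {q // q ∈ D ∧ q ≤ p}) : q.1 ⟶ p := homOfLE q.2.2
  have hf : Sieve.ofArrows _ f ∈ J p := J.superset_covering
    (fun q k hq ↦ Sieve.ofArrows_mk _ f ⟨q, hq, leOfHom k⟩) hD
  obtain ⟨s, hs⟩ := (hJ.2 _ (isCoherentObj_yoneda p)).1 _ _
    (isEpimorphicFamily_presheafToSheaf_yoneda_iff.2 hf)
  refine ⟨s.map (.subtype _), fun q hq ↦ ?_, J.superset_covering ?_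
    (isEpimorphicFamily_presheafToSheaf_yoneda_iff.1 hs)⟩
  · obtain ⟨t, -, rfl⟩ := Finset.mem_map.1 hq
    exact t.2.1
  · rintro r _ ⟨_, g, _, ⟨q⟩, rfl⟩
    exact ⟨q.1, Finset.mem_map_of_mem _ q.2, leOfHom g⟩

end FiniteType

/-! ### Cardinalities -/

section Cardinalities

variable (P : Type u) [PartialOrder P]

lemma p_le_x : p P ≤ x P :=
  Cardinal.mk_le_of_injective (f := fun p : P ↦ PFilter.principal p) fun _ _ h ↦
    le_antisymm (PFilter.principal_le_principal_iff.1 h.ge)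
      (PFilter.principal_le_principal_iff.1 h.le)

lemma infinite_of_infinite_pfilter [Infinite (PFilter P)] : Infinite P :=
  have : Infinite (Set P) :=
    .of_injective (fun F : PFilter P ↦ (F : Set P)) SetLike.coe_injective
  not_finite_iff_infinite.1 fun _ ↦ not_finite (Set P)

lemma mk_upperSet_le_cl : Cardinal.mk (UpperSet P) ≤ cl P :=
  Cardinal.mk_le_of_injective
    (f := fun A ↦ ⟨subsetTopology (A : Set P), isClosedSubtopos_iff.2 ⟨A, rfl⟩⟩)
    fun _ _ h ↦ SetLike.coe_injective (subsetTopology_injective (congrArg Subtype.val h))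

lemma x_le_cl : x P ≤ cl P :=
  (Cardinal.mk_le_of_injective (f := fun F : PFilter P ↦
    (⟨F, fun _ _ h hp ↦ PFilter.mem_of_le h hp⟩ : UpperSet P))
    fun _ _ h ↦ SetLike.coe_injective (congrArg UpperSet.carrier h)).trans (mk_upperSet_le_cl P)

lemma cl_le_coh [CompactSpace (PFilter P)] [QuasiSeparatedSpace (PFilter P)] : cl P ≤ coh P :=
  Cardinal.mk_subtype_mono fun _ hJ ↦ by
    obtain ⟨A, rfl⟩ := isClosedSubtopos_iff.1 hJ
    exact isCoherentSubtopos_subsetTopology isFinitelyGenerated_univ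
      isFinitelyGenerated_Iic_inter_Iic A

lemma coh_le_two_power_p [Infinite P] [QuasiSeparatedSpace (PFilter P)] : coh P ≤ 2 ^ p P := by
  have hcovers : coh P ≤ Cardinal.mk (Set (Finset P × P)) :=
    Cardinal.mk_le_of_injective
      (f := fun J ↦ {t : Finset P × P | Covers J.1 (lowerClosure t.1) t.2}) fun J K h ↦
        Subtype.ext (le_antisymm
          (J.2.isFiniteType.le fun T p ↦ (Set.ext_iff.1 h (T, p)).1)
          (K.2.isFiniteType.le fun T p ↦ (Set.ext_iff.1 h (T, p)).2))
  calc
    coh P ≤ Cardinal.mk (Set (Finset P × P)) := hcovers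
    _ = 2 ^ p P := by
      rw [Cardinal.mk_set, Cardinal.mk_prod, Cardinal.lift_id, Cardinal.lift_id,
        Cardinal.mk_finset_of_infinite, Cardinal.mul_eq_self (Cardinal.aleph0_le_mk P), p]

lemma coh_le_ep [QuasiSeparatedSpace (PFilter P)] : coh P ≤ ep P :=
  Cardinal.mk_subtype_mono fun _ hJ ↦ (IsCoherentSubtopos.isFiniteType hJ).hasEnoughPoints

lemma two_power_p_le_ep : 2 ^ p P ≤ ep P := by
  rw [p, ← Cardinal.mk_set]
  exact Cardinal.mk_le_of_injective
    (f := fun A ↦ ⟨subsetTopology A, hasEnoughPoints_subsetTopology A⟩)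
    fun _ _ h ↦ subsetTopology_injective (congrArg Subtype.val h)

lemma ep_le_two_power_x : ep P ≤ 2 ^ x P := by
  rw [x, ← Cardinal.mk_set]
  exact Cardinal.mk_le_of_injective (f := fun J ↦ {F | IsPointOf J.1 F}) fun J K h ↦
    Subtype.ext (eq_of_isPointOf_iff J.2 K.2 (Set.ext_iff.1 h))

lemma ep_le_gt : ep P ≤ gt P := Cardinal.mk_subtype_le _

lemma gt_le_two_power_cl [Infinite (PFilter P)] : gt P ≤ 2 ^ cl P := by
  have hcovers : gt P ≤ Cardinal.mk (Set (LowerSet P × P)) :=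
    Cardinal.mk_le_of_injective (f := fun J ↦ {t : LowerSet P × P | Covers J t.1 t.2})
      fun _ _ h ↦ ext_of_covers fun D p ↦ Set.ext_iff.1 h (D, p)
  have hlower : Cardinal.mk (LowerSet P) ≤ cl P :=
    (Cardinal.mk_congr upperSetIsoLowerSet.toEquiv).ge.trans (mk_upperSet_le_cl P)
  have hinf : Cardinal.aleph0 ≤ cl P := (Cardinal.aleph0_le_mk (PFilter P)).trans (x_le_cl P)
  have hpairs : Cardinal.mk (LowerSet P × P) ≤ cl P := by
    rw [Cardinal.mk_prod, Cardinal.lift_id, Cardinal.lift_id, ← Cardinal.mul_eq_self hinf]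
    exact mul_le_mul' hlower ((p_le_x P).trans (x_le_cl P))
  calc
    gt P ≤ Cardinal.mk (Set (LowerSet P × P)) := hcovers
    _ = 2 ^ Cardinal.mk (LowerSet P × P) := Cardinal.mk_set
    _ ≤ 2 ^ cl P := Cardinal.power_le_power_left two_ne_zero hpairs

end Cardinalities

end PosetSites

theorem mainTheorem5 (P : Type u) [PartialOrder P]
    (hinf : Infinite (PFilter P)) (hspec : SpectralSpace (PFilter P)) :
    -- bottom row, from left to right
    PosetSites.x P ≤ PosetSites.cl P ∧
    PosetSites.cl P ≤ PosetSites.coh P ∧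
    PosetSites.coh P ≤ 2 ^ PosetSites.p P ∧
    -- from the bottom row to the one above it
    PosetSites.cl P ≤ 2 ^ PosetSites.p P ∧
    PosetSites.coh P ≤ PosetSites.ep P ∧
    (2 : Cardinal.{u}) ^ PosetSites.p P ≤ 2 ^ PosetSites.x P ∧
    -- second row
    2 ^ PosetSites.p P ≤ PosetSites.ep P ∧
    PosetSites.ep P ≤ 2 ^ PosetSites.x P ∧
    -- from the second row to the third
    PosetSites.ep P ≤ PosetSites.gt P ∧
    (2 : Cardinal.{u}) ^ PosetSites.x P ≤ 2 ^ PosetSites.cl P ∧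
    -- third row
    PosetSites.gt P ≤ 2 ^ PosetSites.cl P ∧
    -- from the third row to the top
    (2 : Cardinal.{u}) ^ PosetSites.cl P ≤ 2 ^ ((2 : Cardinal.{u}) ^ PosetSites.p P) := by
  have := PosetSites.infinite_of_infinite_pfilter P
  have hx := PosetSites.x_le_cl P
  have hcl := PosetSites.cl_le_coh P
  have hcoh := PosetSites.coh_le_two_power_p P
  exact ⟨hx, hcl, hcoh, hcl.trans hcoh, PosetSites.coh_le_ep P,
    Cardinal.power_le_power_left two_ne_zero (PosetSites.p_le_x P),
    PosetSites.two_power_p_le_ep P, PosetSites.ep_le_two_power_x P, PosetSites.ep_le_gt P,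
    Cardinal.power_le_power_left two_ne_zero hx, PosetSites.gt_le_two_power_cl P,
    Cardinal.power_le_power_left two_ne_zero (hcl.trans hcoh)⟩
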